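/- Let $n\ge 1$. A $\mathbb Z$-map on the cube $[0,1]^n$ is a (continuous) piecewise linear map with finitely many linear (in the affine sense) pieces, each with integer coefficients. Let $\mathcal M([0,1]^n)$ be the MV-algebra of all $\mathbb Z$-maps $[0,1]^n\to[0,1]$ (McNaughton functions), with the pointwise operations $\neg x=1-x$ and $x\oplus y=\min(1,x+y)$. A $\mathbb Z$-retraction of $[0,1]^n$ is a $\mathbb Z$-map $\rho\colon[0,1]^n\to[0,1]^n$ with $\rho\circ\rho=\rho$; it induces the endomorphism $-\circ\rho\colon f\mapsto f\circ\rho$ of $\mathcal M([0,1]^n)$. A retraction of $\mathcal M([0,1]^n)$ is an idempotent MV-algebra endomorphism of it; its range is called a retract, and the multiplicity of a retract $A$ is the number of distinct retractions of $\mathcal M([0,1]^n)$ with range $A$ (it is $\infty$ if there are infinitely many). Let $A$ be a retract of $\mathcal M([0,1]^n)$, say $A=\operatorname{range}(-\circ\rho)$ for some $\mathbb Z$-retraction $\rho$ of $[0,1]^n$ onto the set (necessarily a rational polyhedron) $P=\rho([0,1]^n)$. Suppose that $P$ is a closed domain in $[0,1]^n$, that is, $P$ is the closure of its interior in $[0,1]^n$.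 Then there is a $\mathbb Z$-retraction $\rho'$ of $[0,1]^n$ onto the same set $P$ such that the retract $A'=\operatorname{range}(-\circ\rho')$ is isomorphic to $A$ as an MV-algebra and the multiplicity of $A'$ is equal to $1$. -/

import Mathlib

/-! MV-algebras, their homomorphisms and subalgebras. -/

/-- An MV-algebra `(A, 0, ¬, ⊕)`. -/
class MVAlgebra (A : Type*) where
  zero : A
  neg : A → A
  oplus : A → A → A
  oplus_assoc : ∀ x y z : A, oplus x (oplus y z) = oplus (oplus x y) z
  oplus_comm : ∀ x y : A, oplus x y = oplus y x
  oplus_zero : ∀ x : A, oplus x zero = x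
  neg_neg : ∀ x : A, neg (neg x) = x
  oplus_neg_zero : ∀ x : A, oplus x (neg zero) = neg zero
  lukasiewicz : ∀ x y : A,
    oplus (neg (oplus (neg x) y)) y = oplus (neg (oplus (neg y) x)) x

/-- A homomorphism of MV-algebras. -/
structure MVHom (A B : Type*) [MVAlgebra A] [MVAlgebra B] where
  toFun : A → B
  map_zero : toFun MVAlgebra.zero = MVAlgebra.zero
  map_neg : ∀ x, toFun (MVAlgebra.neg x) = MVAlgebra.neg (toFun x)
  map_oplus : ∀ x y, toFun (MVAlgebra.oplus x y) = MVAlgebra.oplus (toFun x) (toFun y)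

instance MVHom.instCoeFun {A B : Type*} [MVAlgebra A] [MVAlgebra B] :
    CoeFun (MVHom A B) (fun _ => A → B) := ⟨MVHom.toFun⟩

/-- Isomorphism of MV-algebras: there is a bijective homomorphism. -/
def MVIsomorphic (A B : Type*) [MVAlgebra A] [MVAlgebra B] : Prop :=
  ∃ φ : MVHom A B, Function.Bijective φ

/-- A subalgebra of an MV-algebra. -/
structure MVSubalgebra (A : Type*) [MVAlgebra A] where
  carrier : Set A
  zero_mem : MVAlgebra.zero ∈ carrier
  neg_mem : ∀ x ∈ carrier, MVAlgebra.neg x ∈ carrier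
  oplus_mem : ∀ x ∈ carrier, ∀ y ∈ carrier, MVAlgebra.oplus x y ∈ carrier

instance MVSubalgebra.instCoeSort {A : Type*} [MVAlgebra A] :
    CoeSort (MVSubalgebra A) (Type _) := ⟨fun S => S.carrier⟩

/-- A subalgebra, with the restricted operations, is an MV-algebra. -/
instance MVSubalgebra.instMVAlgebra {A : Type*} [MVAlgebra A] (S : MVSubalgebra A) :
    MVAlgebra S where
  zero := ⟨MVAlgebra.zero, S.zero_mem⟩
  neg x := ⟨MVAlgebra.neg x.1, S.neg_mem _ x.2⟩
  oplus x y := ⟨MVAlgebra.oplus x.1 y.1, S.oplus_mem _ x.2 _ y.2⟩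
  oplus_assoc _ _ _ := Subtype.ext (MVAlgebra.oplus_assoc _ _ _)
  oplus_comm _ _ := Subtype.ext (MVAlgebra.oplus_comm _ _)
  oplus_zero _ := Subtype.ext (MVAlgebra.oplus_zero _)
  neg_neg _ := Subtype.ext (MVAlgebra.neg_neg _)
  oplus_neg_zero _ := Subtype.ext (MVAlgebra.oplus_neg_zero _)
  lukasiewicz _ _ := Subtype.ext (MVAlgebra.lukasiewicz _ _)

/-- The range of a homomorphism, as a subalgebra of the codomain. -/
def MVHom.range {A B : Type*} [MVAlgebra A] [MVAlgebra B] (φ : MVHom A B) :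
    MVSubalgebra B where
  carrier := Set.range φ
  zero_mem := ⟨MVAlgebra.zero, φ.map_zero⟩
  neg_mem := by
    rintro _ ⟨x, rfl⟩
    exact ⟨MVAlgebra.neg x, φ.map_neg x⟩
  oplus_mem := by
    rintro _ ⟨x, rfl⟩ _ ⟨y, rfl⟩
    exact ⟨MVAlgebra.oplus x y, φ.map_oplus x y⟩

/-- `ε` is a retraction of `F` onto the subalgebra `A`: an idempotent endomorphism of `F`
with range `A`. -/
def MVHom.IsRetractionOnto {F : Type*} [MVAlgebra F] (ε : MVHom F F) (A : MVSubalgebra F) :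
    Prop :=
  (∀ f : F, ε (ε f) = ε f) ∧ ε.range = A

/-- A retract of `F` is the range of a retraction of `F`. -/
def MVSubalgebra.IsRetract {F : Type*} [MVAlgebra F] (A : MVSubalgebra F) : Prop :=
  ∃ ε : MVHom F F, ε.IsRetractionOnto A

/-- The multiplicity of `A`: the number of distinct retractions of `F` onto `A`, and `⊤` if
there are infinitely many. -/
noncomputable def MVSubalgebra.retractMultiplicity {F : Type*} [MVAlgebra F]
    (A : MVSubalgebra F) : ℕ∞ :=
  {ε : MVHom F F | ε.IsRetractionOnto A}.encard

/-- The standard MV-algebra `[0,1]`: `¬x = 1 - x` and `x ⊕ y = min 1 (x + y)`. -/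
noncomputable instance unitInterval.instMVAlgebra : MVAlgebra unitInterval where
  zero := 0
  neg x := unitInterval.symm x
  oplus x y := ⟨min 1 ((x : ℝ) + y), le_min zero_le_one (add_nonneg x.2.1 y.2.1), min_le_left _ _⟩
  oplus_assoc x y z := by
    apply Subtype.ext
    have hx := x.2.1
    have hz := z.2.1
    simp only
    rcases le_total (1 : ℝ) ((y : ℝ) + z) with h1 | h1 <;>
    rcases le_total (1 : ℝ) ((x : ℝ) + y) with h2 | h2 <;>
    simp only [min_eq_left h1, min_eq_left h2, min_eq_right h1, min_eq_right h2, add_assoc] <;>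
    (try rw [min_eq_left (by linarith), min_eq_left (by linarith)])
  oplus_comm x y := by
    apply Subtype.ext
    simp only [add_comm]
  oplus_zero x := by
    apply Subtype.ext
    simpa using x.2.2
  neg_neg x := unitInterval.symm_symm x
  oplus_neg_zero x := by
    apply Subtype.ext
    simpa using x.2.1
  lukasiewicz x y := by
    apply Subtype.ext
    have hx := x.2.2
    have hy := y.2.2
    simp only [unitInterval.coe_symm_eq]
    rcases le_total (x : ℝ) y with h | h
    · rw [min_eq_left (by linarith : (1 : ℝ) ≤ 1 - x + y),
        min_eq_right (by linarith : 1 - (y : ℝ) + x ≤ 1)]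
      congr 1
      ring
    · rw [min_eq_right (by linarith : 1 - (x : ℝ) + y ≤ 1),
        min_eq_left (by linarith : (1 : ℝ) ≤ 1 - y + x)]
      congr 1
      ring

/-- Functions into an MV-algebra, with the pointwise operations. -/
instance MVAlgebra.instPi {X A : Type*} [MVAlgebra A] : MVAlgebra (X → A) where
  zero _ := MVAlgebra.zero
  neg f x := MVAlgebra.neg (f x)
  oplus f g x := MVAlgebra.oplus (f x) (g x)
  oplus_assoc _ _ _ := funext fun _ => MVAlgebra.oplus_assoc _ _ _
  oplus_comm _ _ := funext fun _ => MVAlgebra.oplus_comm _ _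
  oplus_zero _ := funext fun _ => MVAlgebra.oplus_zero _
  neg_neg _ := funext fun _ => MVAlgebra.neg_neg _
  oplus_neg_zero _ := funext fun _ => MVAlgebra.oplus_neg_zero _
  lukasiewicz _ _ := funext fun _ => MVAlgebra.lukasiewicz _ _

/-! McNaughton functions and `ℤ`-maps on the unit cube. -/

/-- The unit cube `[0,1]^n`, with the product topology. -/
abbrev UnitCube (n : ℕ) : Type := Fin n → unitInterval

/-- The value at `x` of the affine function with integer coefficients `p.1 i` and integer
constant term `p.2`. -/
def intAffine {n : ℕ} (p : (Fin n → ℤ) × ℤ) (x : UnitCube n) : ℝ :=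
  (∑ i, (p.1 i : ℝ) * (x i : ℝ)) + (p.2 : ℝ)

/-- McNaughton functions: continuous functions that at every point agree with one of finitely
many affine functions with integer coefficients, that is, piecewise linear functions with
finitely many linear pieces, each with integer coefficients. -/
def IsMcNaughton {n : ℕ} (f : UnitCube n → unitInterval) : Prop :=
  Continuous f ∧ ∃ S : Finset ((Fin n → ℤ) × ℤ), ∀ x, ∃ p ∈ S, (f x : ℝ) = intAffine p x

/-- A map into `[0,1]^m` is a `ℤ`-map if all its coordinates are piecewise linear with integer
coefficients. -/
def IsZMap {n m : ℕ} (σ : UnitCube n → UnitCube m) : Prop :=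
  ∀ j, IsMcNaughton (fun x => σ x j)

/-- A `ℤ`-retraction of the cube is an idempotent `ℤ`-map. -/
structure IsZRetraction {n : ℕ} (σ : UnitCube n → UnitCube n) : Prop where
  isZMap : IsZMap σ
  idem : σ ∘ σ = σ

theorem isMcNaughton_zero {n : ℕ} :
    IsMcNaughton (MVAlgebra.zero : UnitCube n → unitInterval) := by
  refine ⟨continuous_const, {(0, 0)}, fun x => ⟨(0, 0), by simp, ?_⟩⟩
  change ((0 : unitInterval) : ℝ) = _
  simp [intAffine]

theorem IsMcNaughton.neg {n : ℕ} {f : UnitCube n → unitInterval} (hf : IsMcNaughton f) :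
    IsMcNaughton (MVAlgebra.neg f) := by
  classical
  obtain ⟨hc, S, hS⟩ := hf
  refine ⟨unitInterval.continuous_symm.comp hc, S.image fun p => (-p.1, 1 - p.2), fun x => ?_⟩
  obtain ⟨p, hp, h⟩ := hS x
  refine ⟨_, Finset.mem_image_of_mem _ hp, ?_⟩
  change 1 - (f x : ℝ) = _
  rw [h]
  simp [intAffine]
  ring

theorem IsMcNaughton.oplus {n : ℕ} {f g : UnitCube n → unitInterval} (hf : IsMcNaughton f)
    (hg : IsMcNaughton g) : IsMcNaughton (MVAlgebra.oplus f g) := by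
  classical
  obtain ⟨hc, S, hS⟩ := hf
  obtain ⟨hd, T, hT⟩ := hg
  refine ⟨?_, insert (0, 1) ((S ×ˢ T).image fun q => (q.1.1 + q.2.1, q.1.2 + q.2.2)), fun x => ?_⟩
  · apply Continuous.subtype_mk
    fun_prop
  · have key : ((MVAlgebra.oplus f g x : unitInterval) : ℝ) = min 1 ((f x : ℝ) + g x) := rfl
    rw [key]
    rcases le_total (1 : ℝ) ((f x : ℝ) + g x) with h1 | h1
    · exact ⟨(0, 1), Finset.mem_insert_self _ _, by rw [min_eq_left h1]; simp [intAffine]⟩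
    · obtain ⟨p, hp, h⟩ := hS x
      obtain ⟨q, hq, h'⟩ := hT x
      refine ⟨(p.1 + q.1, p.2 + q.2), Finset.mem_insert_of_mem
        (Finset.mem_image.2 ⟨(p, q), Finset.mem_product.2 ⟨hp, hq⟩, rfl⟩), ?_⟩
      rw [min_eq_right h1, h, h']
      simp only [intAffine, Pi.add_apply, Int.cast_add, add_mul, Finset.sum_add_distrib]
      ring

theorem IsMcNaughton.comp {n m : ℕ} {f : UnitCube m → unitInterval} (hf : IsMcNaughton f)
    {σ : UnitCube n → UnitCube m} (hσ : IsZMap σ) : IsMcNaughton (f ∘ σ) := by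
  classical
  obtain ⟨hc, S, hS⟩ := hf
  choose hd T hT using hσ
  refine ⟨hc.comp (continuous_pi hd), (S ×ˢ Fintype.piFinset T).image
    fun q => (fun i => ∑ j, q.1.1 j * (q.2 j).1 i, (∑ j, q.1.1 j * (q.2 j).2) + q.1.2),
    fun x => ?_⟩
  obtain ⟨p, hp, h⟩ := hS (σ x)
  choose t ht ht' using fun j => hT j x
  refine ⟨_, Finset.mem_image.2 ⟨(p, t), Finset.mem_product.2
    ⟨hp, Fintype.mem_piFinset.2 ht⟩, rfl⟩, ?_⟩
  rw [Function.comp_apply, h]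
  simp only [intAffine] at ht' ⊢
  simp only [ht', Int.cast_add, Int.cast_sum, Int.cast_mul, mul_add, Finset.sum_add_distrib,
    Finset.mul_sum, Finset.sum_mul]
  rw [Finset.sum_comm]
  simp only [mul_assoc, add_assoc]

/-- The MV-algebra of McNaughton functions on `[0,1]^n`, with pointwise operations. -/
def McN (n : ℕ) : MVSubalgebra (UnitCube n → unitInterval) where
  carrier := {f | IsMcNaughton f}
  zero_mem := isMcNaughton_zero
  neg_mem _ hf := hf.neg
  oplus_mem _ hf _ hg := hf.oplus hg

/-- The endomorphism `- ∘ σ` of the MV-algebra of McNaughton functions, `f ↦ f ∘ σ`. -/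
def McN.precomp {n : ℕ} (σ : UnitCube n → UnitCube n) (hσ : IsZMap σ) :
    MVHom (McN n) (McN n) where
  toFun f := ⟨f.1 ∘ σ, IsMcNaughton.comp f.2 hσ⟩
  map_zero := rfl
  map_neg _ := rfl
  map_oplus _ _ := rfl

/-- A (Kuratowski) closed domain: a set equal to the closure of its interior. -/
def IsClosedDomain {X : Type*} [TopologicalSpace X] (D : Set X) : Prop :=
  closure (interior D) = D

/-! The retraction `ρ` is changed only off `P`, so that no `ℤ`-map can have a local section of it
through points outside `P`. Take a McNaughton function `g` with zero set `P` and put `κ x i = min 1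
(x i + 3 * v i * g x)` for a suitable positive integer vector `v`. Then `κ` fixes `P`, and its
pieces off `P` have determinant different from `±1`: either a truncated row vanishes, or the linear
part is `1 + 3 v mᵀ`, with determinant `1 + 3 (m · v)` and `m · v ≠ 0`. Set `ρ' = ρ ∘ κ`.

By duality (`McN.exists_eq_precomp`) a retraction with the same range is `- ∘ σ`, with `ρ' ∘ σ = ρ'`
and `σ ∘ ρ' = σ`. So `ρ ∘ κ ∘ σ` is the identity on `P`. If `σ` left `P` at an interior point of
`P`, a product of three integer matrices, one of them a piece of `κ` off `P`, would be the identity,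
which determinants forbid (`isUnit_det_of_comp_eq_id`). Hence `σ` is the identity on the interior of
`P`, on `P` by closure, and `σ = σ ∘ ρ' = ρ'`. -/

theorem MVHom.ext {A B : Type*} [MVAlgebra A] [MVAlgebra B] {φ ψ : MVHom A B}
    (h : ∀ x, φ x = ψ x) : φ = ψ := by
  cases φ; cases ψ
  congr
  exact funext h

theorem unitInterval.coe_mvZero : ((MVAlgebra.zero : unitInterval) : ℝ) = 0 := rfl

theorem unitInterval.coe_mvNeg (x : unitInterval) :
    ((MVAlgebra.neg x : unitInterval) : ℝ) = 1 - x := rfl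

theorem unitInterval.coe_mvOplus (x y : unitInterval) :
    ((MVAlgebra.oplus x y : unitInterval) : ℝ) = min 1 ((x : ℝ) + y) := rfl

/-! ### Duality: homomorphisms to `[0,1]` are evaluations, endomorphisms come from `ℤ`-maps. -/

namespace McN

variable {n : ℕ}

theorem continuous_coe (f : McN n) : Continuous fun x => (f.1 x : ℝ) :=
  continuous_subtype_val.comp f.2.1

theorem coe_oplus_apply (f g : McN n) (x : UnitCube n) :
    ((MVAlgebra.oplus f g).1 x : ℝ) = min 1 ((f.1 x : ℝ) + g.1 x) := rfl

theorem coe_neg_apply (f : McN n) (x : UnitCube n) :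
    ((MVAlgebra.neg f).1 x : ℝ) = 1 - f.1 x := rfl

/-- The coordinate projections of the cube are McNaughton functions. -/
def proj (i : Fin n) : McN n :=
  ⟨fun x => x i, continuous_apply i, {(Pi.single i 1, 0)}, fun x =>
    ⟨_, Finset.mem_singleton_self _, by simp [intAffine, Pi.single_apply]⟩⟩

/-- Compactness: the kernel is closed under `⊕`, so without a common zero it would contain an
everywhere positive function, and then, by adding copies of it, the constant `1`, which `φ` sends to
`1`. -/
theorem exists_zero_of_kernel (φ : MVHom (McN n) unitInterval) :
    ∃ z : UnitCube n, ∀ f : McN n, (φ f : ℝ) = 0 → (f.1 z : ℝ) = 0 := by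
  by_contra! H
  obtain ⟨f, hf0, hf⟩ : ∃ f : McN n, (φ f : ℝ) = 0 ∧ ∀ z ∈ (Set.univ : Set (UnitCube n)),
      0 < (f.1 z : ℝ) := by
    refine isCompact_univ.induction_on
      (p := fun s => ∃ f : McN n, (φ f : ℝ) = 0 ∧ ∀ z ∈ s, 0 < (f.1 z : ℝ)) ?_ ?_ ?_ ?_
    · exact ⟨MVAlgebra.zero, by rw [φ.map_zero]; rfl, by simp⟩
    · rintro s t hst ⟨f, hf, h⟩
      exact ⟨f, hf, fun z hz => h z (hst hz)⟩
    · rintro s t ⟨f, hf, h⟩ ⟨g, hg, h'⟩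
      refine ⟨MVAlgebra.oplus f g, ?_, ?_⟩
      · rw [φ.map_oplus, unitInterval.coe_mvOplus, hf, hg]
        norm_num
      · intro z hz
        rw [coe_oplus_apply]
        have h1 := (f.1 z).2.1
        have h2 := (g.1 z).2.1
        refine lt_min one_pos ?_
        rcases hz with hz | hz
        · linarith [h z hz]
        · linarith [h' z hz]
    · intro z _
      obtain ⟨f, hf, h⟩ := H z
      exact ⟨{x | 0 < (f.1 x : ℝ)},
        mem_nhdsWithin_of_mem_nhds ((isOpen_lt continuous_const (continuous_coe f)).mem_nhds
          (lt_of_le_of_ne (f.1 z).2.1 h.symm)), f, hf, fun _ hx => hx⟩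
  obtain ⟨z₀, -, hz₀⟩ := isCompact_univ.exists_isMinOn Set.univ_nonempty
    (continuous_coe f).continuousOn
  have hpos := hf z₀ trivial
  obtain ⟨m, hm⟩ := exists_nat_ge (1 / (f.1 z₀ : ℝ))
  have key : ∀ k : ℕ, ∃ h : McN n, (φ h : ℝ) = 0 ∧ ∀ z, min 1 (k * (f.1 z₀ : ℝ)) ≤ h.1 z := by
    intro k
    induction k with
    | zero => exact ⟨MVAlgebra.zero, by rw [φ.map_zero]; rfl, fun z => by
        rw [Nat.cast_zero, zero_mul, min_eq_right zero_le_one]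
        exact ((MVAlgebra.zero : UnitCube n → unitInterval) z).2.1⟩
    | succ k ih =>
      obtain ⟨h, hh, hk⟩ := ih
      refine ⟨MVAlgebra.oplus h f, ?_, fun z => ?_⟩
      · rw [φ.map_oplus, unitInterval.coe_mvOplus, hh, hf0]
        norm_num
      · rw [coe_oplus_apply]
        have h1 : (f.1 z₀ : ℝ) ≤ f.1 z := hz₀ (Set.mem_univ z)
        refine le_min (min_le_left _ _) ?_
        rcases min_le_iff.1 (hk z) with h2 | h2
        · exact (min_le_left _ _).trans (by linarith)
        · refine (min_le_right _ _).trans ?_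
          push_cast
          linarith
  obtain ⟨h, hh, hm'⟩ := key m
  have h1 : h = MVAlgebra.neg MVAlgebra.zero := by
    refine Subtype.ext (funext fun z => Subtype.ext ?_)
    rw [coe_neg_apply]
    change (h.1 z : ℝ) = 1 - 0
    have := hm' z
    rw [min_eq_left ((div_le_iff₀ hpos).1 hm)] at this
    linarith [(h.1 z).2.2]
  rw [h1, φ.map_neg, φ.map_zero, unitInterval.coe_mvNeg, unitInterval.coe_mvZero] at hh
  norm_num at hh

/-- A positive gap `f z - φ f` can be doubled by passing to `f ⊕ f` or `f ⊙ f`, until it reaches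
`1`; then `φ f = 0` and `f z = 1`, against the choice of `z`. -/
theorem not_lt_of_kernel (φ : MVHom (McN n) unitInterval) (z : UnitCube n)
    (hz : ∀ f : McN n, (φ f : ℝ) = 0 → (f.1 z : ℝ) = 0) (k : ℕ) :
    ∀ f : McN n, ¬ 1 ≤ 2 ^ k * ((f.1 z : ℝ) - φ f) := by
  induction k with
  | zero =>
    intro f hf
    have h1 := (φ f).2.1
    have h2 := (f.1 z).2.2
    have := hz f (by linarith)
    linarith
  | succ k ih =>
    intro f hf
    have hlt : (φ f : ℝ) < f.1 z := by
      have h2 : (0 : ℝ) < 2 ^ (k + 1) := by positivity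
      by_contra! h
      nlinarith
    rw [pow_succ] at hf
    rcases le_total (f.1 z : ℝ) (1 / 2) with h | h
    · refine ih (MVAlgebra.oplus f f) ?_
      rw [coe_oplus_apply, φ.map_oplus, unitInterval.coe_mvOplus, min_eq_right (by linarith),
        min_eq_right (by linarith)]
      linarith
    -- This element is `f ⊙ f`, with values `max 0 (2 f - 1)`.
    · have e1 : (φ (MVAlgebra.neg (MVAlgebra.oplus (MVAlgebra.neg f) (MVAlgebra.neg f))) : ℝ) =
          1 - min 1 (1 - (φ f : ℝ) + (1 - (φ f : ℝ))) := by
        rw [φ.map_neg, φ.map_oplus, φ.map_neg]; rfl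
      have e2 : ((MVAlgebra.neg (MVAlgebra.oplus (MVAlgebra.neg f) (MVAlgebra.neg f))).1 z : ℝ) =
          1 - min 1 (1 - (f.1 z : ℝ) + (1 - (f.1 z : ℝ))) := rfl
      rw [min_eq_right (by linarith)] at e2
      rcases le_total (φ f : ℝ) (1 / 2) with h' | h'
      · rw [min_eq_left (by linarith)] at e1
        -- Here `f ⊙ f` lies in the kernel, so it vanishes at `z`; this forces `f z = 1/2`, and `f ⊕
        -- f` doubles the gap after all.
        have e3 := hz _ (e1.trans (sub_self 1))
        have e4 : (f.1 z : ℝ) = 1 / 2 := by linarith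
        refine ih (MVAlgebra.oplus f f) ?_
        rw [coe_oplus_apply, φ.map_oplus, unitInterval.coe_mvOplus, min_eq_right (by linarith),
          min_eq_right (by linarith)]
        linarith
      · rw [min_eq_right (by linarith)] at e1
        refine ih (MVAlgebra.neg (MVAlgebra.oplus (MVAlgebra.neg f) (MVAlgebra.neg f))) ?_
        rw [e1, e2]
        linarith

/-- Every homomorphism of `McN n` into `[0,1]` is the evaluation at a point. -/
theorem exists_eq_eval (φ : MVHom (McN n) unitInterval) :
    ∃ z : UnitCube n, ∀ f : McN n, φ f = f.1 z := by
  obtain ⟨z, hz⟩ := exists_zero_of_kernel φ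
  have hle : ∀ f : McN n, (f.1 z : ℝ) ≤ φ f := by
    intro f
    by_contra! h
    have hpos := sub_pos.2 h
    obtain ⟨k, hk⟩ := pow_unbounded_of_one_lt (1 / ((f.1 z : ℝ) - φ f)) one_lt_two
    exact not_lt_of_kernel φ z hz k f ((div_le_iff₀ hpos).1 hk.le)
  refine ⟨z, fun f => Subtype.ext (le_antisymm ?_ (hle f))⟩
  have := hle (MVAlgebra.neg f)
  rw [φ.map_neg, coe_neg_apply, unitInterval.coe_mvNeg] at this
  linarith

/-- Every endomorphism of `McN n` is induced by a `ℤ`-map. -/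
theorem exists_eq_precomp (ε : MVHom (McN n) (McN n)) :
    ∃ (σ : UnitCube n → UnitCube n) (hσ : IsZMap σ), ε = precomp σ hσ := by
  have H : ∀ x, ∃ z : UnitCube n, ∀ f : McN n, (ε f).1 x = f.1 z := fun x =>
    exists_eq_eval
      { toFun := fun f => (ε f).1 x
        map_zero := by rw [ε.map_zero]; rfl
        map_neg := fun f => by rw [ε.map_neg]; rfl
        map_oplus := fun f g => by rw [ε.map_oplus]; rfl }
  choose σ hσ using H
  refine ⟨σ, fun j => ?_, MVHom.ext fun f => Subtype.ext (funext fun x => hσ x f)⟩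
  have h : (fun x => σ x j) = (ε (proj j)).1 := funext fun x => (hσ x (proj j)).symm
  rw [h]
  exact (ε (proj j)).2

end McN

/-! ### Affine pieces of `ℤ`-maps and their linear parts. -/

theorem IsZMap.continuous {n m : ℕ} {σ : UnitCube n → UnitCube m} (hσ : IsZMap σ) :
    Continuous σ := continuous_pi fun j => (hσ j).1

theorem IsZMap.comp {n m k : ℕ} {τ : UnitCube m → UnitCube k} {σ : UnitCube n → UnitCube m}
    (hτ : IsZMap τ) (hσ : IsZMap σ) : IsZMap (τ ∘ σ) := fun j => (hτ j).comp hσ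

/-- `σ` agrees at `x` with the affine map with coordinates `t`. -/
def AgreesAt {n m : ℕ} (σ : UnitCube n → UnitCube m) (t : Fin m → (Fin n → ℤ) × ℤ)
    (x : UnitCube n) : Prop :=
  ∀ i, (σ x i : ℝ) = intAffine (t i) x

/-- The linear part of the affine map with coordinates `t`. -/
def linearPart {n m : ℕ} (t : Fin m → (Fin n → ℤ) × ℤ) : Matrix (Fin m) (Fin n) ℤ :=
  Matrix.of fun i => (t i).1

theorem IsZMap.exists_agreesAt {n m : ℕ} {σ : UnitCube n → UnitCube m} (hσ : IsZMap σ) :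
    ∃ T : Finset (Fin m → (Fin n → ℤ) × ℤ), ∀ x, ∃ t ∈ T, AgreesAt σ t x := by
  choose hc S hS using hσ
  refine ⟨Fintype.piFinset S, fun x => ?_⟩
  choose t ht ht' using fun j => hS j x
  exact ⟨t, Fintype.mem_piFinset.2 ht, ht'⟩

theorem continuous_intAffine {n : ℕ} (p : (Fin n → ℤ) × ℤ) :
    Continuous (intAffine p : UnitCube n → ℝ) := by
  unfold intAffine
  fun_prop

theorem isClosed_setOf_agreesAt {n m : ℕ} {σ : UnitCube n → UnitCube m} (hσ : Continuous σ)
    (t : Fin m → (Fin n → ℤ) × ℤ) : IsClosed {x | AgreesAt σ t x} := by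
  simp only [AgreesAt, Set.ofPred_forall]
  refine isClosed_iInter fun i => isClosed_eq ?_ (continuous_intAffine _)
  exact continuous_subtype_val.comp ((continuous_apply i).comp hσ)

theorem AgreesAt.sub_eq {n m : ℕ} {σ : UnitCube n → UnitCube m} {t : Fin m → (Fin n → ℤ) × ℤ}
    {x y : UnitCube n} (hx : AgreesAt σ t x) (hy : AgreesAt σ t y) :
    (fun i => (σ x i : ℝ) - σ y i) =
      ((linearPart t).map (Int.cast : ℤ → ℝ)).mulVec fun j => (x j : ℝ) - y j := by
  funext i
  rw [hx i, hy i]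
  simp [intAffine, Matrix.mulVec, dotProduct, linearPart, mul_sub, Finset.sum_sub_distrib]

/-- An open set covered by finitely many closed sets contains a nonempty open subset of one of
them. -/
theorem exists_isOpen_subset_of_cover {X ι : Type*} [TopologicalSpace X] (T : Finset ι)
    {C : ι → Set X} (hC : ∀ i, IsClosed (C i)) {U : Set X} (hU : IsOpen U) (hne : U.Nonempty)
    (hcov : ∀ x ∈ U, ∃ i ∈ T, x ∈ C i) :
    ∃ i ∈ T, ∃ V ⊆ U, IsOpen V ∧ V.Nonempty ∧ V ⊆ C i := by
  classical
  induction T using Finset.induction_on generalizing U with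
  | empty =>
    obtain ⟨x, hx⟩ := hne
    simpa using hcov x hx
  | insert a s _ ih =>
    by_cases h : U ⊆ C a
    · exact ⟨a, Finset.mem_insert_self _ _, U, subset_rfl, hU, hne, h⟩
    · obtain ⟨i, hi, V, hV, hV'⟩ := ih (hU.inter (hC a).isOpen_compl)
        (by obtain ⟨x, hx, hx'⟩ := Set.not_subset.1 h; exact ⟨x, hx, hx'⟩)
        (fun x hx => by
          obtain ⟨i, hi, hxi⟩ := hcov x hx.1
          rcases Finset.mem_insert.1 hi with rfl | hi
          · exact absurd hxi hx.2
          · exact ⟨i, hi, hxi⟩)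
      exact ⟨i, Finset.mem_insert_of_mem hi, V, hV.trans Set.inter_subset_left, hV'⟩

/-- `[0,1]` has no isolated points. The resulting difference is a nonzero multiple of a basis
vector, which isolates one column of a matrix. -/
theorem exists_update_mem_of_isOpen {n : ℕ} {V : Set (UnitCube n)} (hV : IsOpen V)
    {x : UnitCube n} (hx : x ∈ V) (j : Fin n) :
    ∃ a : unitInterval, a ≠ x j ∧ Function.update x j a ∈ V := by
  have hc : Continuous fun a : unitInterval => Function.update x j a :=
    continuous_const.update j continuous_id
  have hopen : IsOpen {a : unitInterval | Function.update x j a ∈ V} := hV.preimage hc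
  by_contra! H
  have hs : {a : unitInterval | Function.update x j a ∈ V} = {x j} := by
    ext a
    refine ⟨fun ha => ?_, ?_⟩
    · by_contra hne
      exact H a hne ha
    · rintro rfl
      simpa using hx
  rw [hs] at hopen
  exact not_isOpen_singleton (x j) hopen

/-- An integer matrix that fixes all differences of points of a nonempty open subset of the cube
is the identity. -/
theorem eq_one_of_mulVec_sub_eq {n : ℕ} {V : Set (UnitCube n)} (hV : IsOpen V)
    (hne : V.Nonempty) (M : Matrix (Fin n) (Fin n) ℤ)
    (hM : ∀ x ∈ V, ∀ y ∈ V, (M.map (Int.cast : ℤ → ℝ)).mulVec (fun j => (x j : ℝ) - y j) =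
      fun j => (x j : ℝ) - y j) : M = 1 := by
  obtain ⟨x, hx⟩ := hne
  ext i j
  obtain ⟨a, ha, haV⟩ := exists_update_mem_of_isOpen hV hx j
  have ha' : (a : ℝ) - x j ≠ 0 := sub_ne_zero.2 fun h => ha (Subtype.ext h)
  have hd : (fun k => ((Function.update x j a k : unitInterval) : ℝ) - x k) =
      Pi.single j ((a : ℝ) - x j) := by
    funext k
    by_cases hk : k = j
    · subst hk; simp
    · simp [hk]
  have h := hM _ haV _ hx
  rw [hd, Matrix.mulVec_single] at h
  have h' := congrFun h i
  by_cases hij : i = j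
  · subst hij
    simp only [Pi.single_eq_same] at h'
    have h2 : (M i i : ℝ) * ((a : ℝ) - x i) = 1 * ((a : ℝ) - x i) := by simpa using h'
    rw [Matrix.one_apply_eq]
    exact_mod_cast mul_right_cancel₀ ha' h2
  · rw [Matrix.one_apply_ne hij]
    have h2 : (M i j : ℝ) = 0 := by simpa [hij, ha'] using h'
    exact_mod_cast h2

/-- If `τ ∘ κ ∘ σ` is the identity on a nonempty open set, then `κ` has somewhere on the image of
that set a piece with unimodular linear part. -/
theorem isUnit_det_of_comp_eq_id {n : ℕ} {τ κ σ : UnitCube n → UnitCube n} (hτ : IsZMap τ)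
    (hκ : Continuous κ) (hσ : IsZMap σ) {U : Set (UnitCube n)} (hU : IsOpen U)
    (hne : U.Nonempty) (hid : ∀ x ∈ U, τ (κ (σ x)) = x)
    (T : Finset (Fin n → (Fin n → ℤ) × ℤ)) (hT : ∀ x ∈ U, ∃ t ∈ T, AgreesAt κ t (σ x) ∧
      ¬ IsUnit (linearPart t).det) : False := by
  classical
  obtain ⟨R, hR⟩ := hτ.exists_agreesAt
  obtain ⟨S, hS⟩ := hσ.exists_agreesAt
  set T' := T.filter fun t => ¬ IsUnit (linearPart t).det
  -- Finitely many triples of pieces cover `U`, so a single triple serves a whole nonempty open set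
  -- `V`.
  obtain ⟨⟨r, t, s⟩, hmem, V, hVU, hV, hVne, hVC⟩ := exists_isOpen_subset_of_cover
    (R ×ˢ T' ×ˢ S) (C := fun q => {x | AgreesAt τ q.1 (κ (σ x)) ∧ AgreesAt κ q.2.1 (σ x) ∧
      AgreesAt σ q.2.2 x}) (fun q =>
        ((isClosed_setOf_agreesAt hτ.continuous q.1).preimage (hκ.comp hσ.continuous)).inter
        (((isClosed_setOf_agreesAt hκ q.2.1).preimage hσ.continuous).inter
          (isClosed_setOf_agreesAt hσ.continuous q.2.2))) hU hne (fun x hx => by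
      obtain ⟨t, ht, ht', hdet⟩ := hT x hx
      obtain ⟨r, hr, hr'⟩ := hR (κ (σ x))
      obtain ⟨s, hs, hs'⟩ := hS x
      exact ⟨(r, t, s), Finset.mem_product.2 ⟨hr, Finset.mem_product.2
        ⟨Finset.mem_filter.2 ⟨ht, hdet⟩, hs⟩⟩, hr', ht', hs'⟩)
  have hdet : ¬ IsUnit (linearPart t).det :=
    (Finset.mem_filter.1 (Finset.mem_product.1 (Finset.mem_product.1 hmem).2).1).2
  have hone : linearPart r * linearPart t * linearPart s = 1 := by
    refine eq_one_of_mulVec_sub_eq hV hVne _ fun x hx y hy => ?_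
    obtain ⟨x1, x2, x3⟩ := hVC hx
    obtain ⟨y1, y2, y3⟩ := hVC hy
    have h1 := x1.sub_eq y1
    rw [x2.sub_eq y2, x3.sub_eq y3, hid x (hVU hx), hid y (hVU hy)] at h1
    refine Eq.trans ?_ h1.symm
    simp only [Matrix.mulVec_mulVec]
    congr 1
    ext i j
    simp [Matrix.mul_apply, Finset.mul_sum, mul_assoc]
  have hd := congrArg Matrix.det hone
  rw [Matrix.det_mul, Matrix.det_mul, Matrix.det_one] at hd
  exact hdet (IsUnit.of_mul_eq_one ((linearPart r).det * (linearPart s).det) (by linarith))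

/-! ### Zero sets of McNaughton functions and the perturbation `κ`. -/

/-- The witness is the distance `(f ⊖ g) ⊕ (g ⊖ f)`, with values `|f - g|`. -/
theorem IsMcNaughton.exists_zero_iff_eq {n : ℕ} {f g : UnitCube n → unitInterval}
    (hf : IsMcNaughton f) (hg : IsMcNaughton g) :
    ∃ h : UnitCube n → unitInterval, IsMcNaughton h ∧ ∀ x, (h x : ℝ) = 0 ↔ f x = g x := by
  refine ⟨_, (hf.neg.oplus hg).neg.oplus (hg.neg.oplus hf).neg, fun x => ?_⟩
  change min 1 (1 - min 1 (1 - (f x : ℝ) + g x) + (1 - min 1 (1 - (g x : ℝ) + f x))) = 0 ↔ _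
  rw [Subtype.ext_iff]
  rcases le_total (f x : ℝ) (g x) with h | h
  · rw [min_eq_left (a := (1 : ℝ)) (b := 1 - (f x : ℝ) + g x) (by linarith),
      min_eq_right (a := (1 : ℝ)) (b := 1 - (g x : ℝ) + f x) (by linarith),
      min_eq_right (by linarith [(f x).2.1, (g x).2.2])]
    constructor <;> intro h <;> linarith
  · rw [min_eq_right (a := (1 : ℝ)) (b := 1 - (f x : ℝ) + g x) (by linarith),
      min_eq_left (a := (1 : ℝ)) (b := 1 - (g x : ℝ) + f x) (by linarith),
      min_eq_right (by linarith [(g x).2.1, (f x).2.2])]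
    constructor <;> intro h <;> linarith

/-- The set where two `ℤ`-maps agree is the zero set of a McNaughton function. -/
theorem IsZMap.exists_zero_iff_eq {n m : ℕ} {σ τ : UnitCube n → UnitCube m} (hσ : IsZMap σ)
    (hτ : IsZMap τ) :
    ∃ h : UnitCube n → unitInterval, IsMcNaughton h ∧ ∀ x, (h x : ℝ) = 0 ↔ σ x = τ x := by
  classical
  have key : ∀ s : Finset (Fin m), ∃ h : UnitCube n → unitInterval, IsMcNaughton h ∧
      ∀ x, (h x : ℝ) = 0 ↔ ∀ i ∈ s, σ x i = τ x i := by
    intro s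
    induction s using Finset.induction_on with
    | empty => exact ⟨_, isMcNaughton_zero, fun x => ⟨fun _ => by simp, fun _ => rfl⟩⟩
    | insert a s _ ih =>
      obtain ⟨h, hh, hs⟩ := ih
      obtain ⟨k, hk, hk'⟩ := (hσ a).exists_zero_iff_eq (hτ a)
      refine ⟨_, hk.oplus hh, fun x => ?_⟩
      change min 1 ((k x : ℝ) + h x) = 0 ↔ _
      rw [Finset.forall_mem_insert, ← hs x, ← hk' x]
      have h1 := (k x).2.1
      have h2 := (h x).2.1
      constructor
      · intro h3
        rcases min_choice (1 : ℝ) ((k x : ℝ) + h x) with h4 | h4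
        · rw [h4] at h3; norm_num at h3
        · rw [h4] at h3
          constructor <;> linarith
      · rintro ⟨h3, h4⟩
        rw [h3, h4]; norm_num
  obtain ⟨h, hh, hs⟩ := key Finset.univ
  exact ⟨h, hh, fun x => by rw [hs, funext_iff]; simp⟩

theorem IsMcNaughton.exists_min_add_nat_mul {n : ℕ} {f g : UnitCube n → unitInterval}
    (hf : IsMcNaughton f) (hg : IsMcNaughton g) (k : ℕ) :
    ∃ h : UnitCube n → unitInterval, IsMcNaughton h ∧
      ∀ x, (h x : ℝ) = min 1 ((f x : ℝ) + k * g x) := by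
  induction k with
  | zero => exact ⟨f, hf, fun x => by simpa using (f x).2.2⟩
  | succ k ih =>
    obtain ⟨h, hh, hk⟩ := ih
    refine ⟨_, hh.oplus hg, fun x => ?_⟩
    change min 1 ((h x : ℝ) + g x) = _
    rw [hk]
    have h1 := (g x).2.1
    push_cast
    rcases le_total 1 ((f x : ℝ) + k * g x) with h2 | h2
    · rw [min_eq_left h2, min_eq_left (by linarith), min_eq_left (by linarith)]
    · rw [min_eq_right h2]
      congr 1
      ring

/-- Finitely many nonzero integer vectors admit a positive vector orthogonal to none of them. -/
theorem exists_pos_dotProduct_ne_zero {n : ℕ} (S : Finset (Fin n → ℤ)) (hS : ∀ m ∈ S, m ≠ 0) :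
    ∃ v : Fin n → ℕ, (∀ i, 0 < v i) ∧ ∀ m ∈ S, ∑ i, m i * (v i : ℤ) ≠ 0 := by
  classical
  -- The product of `m` with `(1, N, N², …)` is the value at `N` of the polynomial with coefficients
  -- `m`; any `N > 0` off finitely many roots works.
  let q : (Fin n → ℤ) → Polynomial ℤ := fun m => ∑ i : Fin n, Polynomial.monomial (i : ℕ) (m i)
  have hq : ∀ m ∈ S, q m ≠ 0 := by
    intro m hm h0
    refine hS m hm (funext fun i => ?_)
    have h1 := congrArg (fun p : Polynomial ℤ => p.coeff i) h0
    simpa [q, Polynomial.finsetSum_coeff, Polynomial.coeff_monomial, Fin.val_inj] using h1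
  have hfin : {N : ℕ | (N : ℤ) ∈ (∏ m ∈ S, q m).roots.toFinset}.Finite :=
    (Finset.finite_toSet _).preimage Nat.cast_injective.injOn
  obtain ⟨N, hN, hN0⟩ := (hfin.union (Set.finite_singleton 0)).infinite_compl.nonempty.imp
    fun N hN => not_or.1 hN
  refine ⟨fun i => N ^ (i : ℕ), fun i => pow_pos (Nat.pos_of_ne_zero hN0) _, fun m hm h => hN ?_⟩
  have hprod : (∏ m ∈ S, q m) ≠ 0 := Finset.prod_ne_zero_iff.2 hq
  change (N : ℤ) ∈ (∏ m ∈ S, q m).roots.toFinset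
  rw [Multiset.mem_toFinset, Polynomial.mem_roots hprod, Polynomial.IsRoot.def,
    Polynomial.eval_prod]
  refine Finset.prod_eq_zero hm ?_
  simpa [q, Polynomial.eval_finsetSum] using h

/-- The determinant of a rank-one perturbation of the identity is `1 + 3 (m · v)`. The factor `3`
keeps it away from `-1` as well as `1`; a factor `2` would allow `-1`. -/
theorem not_isUnit_det_one_add {n : ℕ} (v m : Fin n → ℤ) (h : ∑ i, m i * v i ≠ 0) :
    ¬ IsUnit (Matrix.of fun i => (Pi.single i 1 + (3 * v i) • m : Fin n → ℤ)).det := by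
  have e : (Matrix.of fun i => (Pi.single i 1 + (3 * v i) • m : Fin n → ℤ)) =
      1 + Matrix.replicateCol Unit (fun i => 3 * v i) * Matrix.replicateRow Unit m := by
    ext i j
    simp [Matrix.one_apply, Pi.single_apply, Matrix.mul_apply, eq_comm]
  rw [e, Matrix.det_one_add_replicateCol_mul_replicateRow]
  have e2 : m ⬝ᵥ (fun i => 3 * v i) = 3 * ∑ i, m i * v i := by
    rw [dotProduct, Finset.mul_sum]
    exact Finset.sum_congr rfl fun i _ => by ring
  rw [e2, Int.isUnit_iff]
  omega

/-- A `ℤ`-map that fixes the zeros of `g` and has no unimodular piece elsewhere. -/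
theorem IsMcNaughton.exists_isZMap_fixing_zeros {n : ℕ} (hn : 1 ≤ n)
    {g : UnitCube n → unitInterval} (hg : IsMcNaughton g) :
    ∃ κ : UnitCube n → UnitCube n, IsZMap κ ∧ (∀ x, (g x : ℝ) = 0 → κ x = x) ∧
      ∃ T : Finset (Fin n → (Fin n → ℤ) × ℤ), ∀ x, (g x : ℝ) ≠ 0 →
        ∃ t ∈ T, AgreesAt κ t x ∧ ¬ IsUnit (linearPart t).det := by
  classical
  obtain ⟨S, hS⟩ := hg.2
  obtain ⟨v, hv, hvS⟩ := exists_pos_dotProduct_ne_zero ((S.image Prod.fst).filter (· ≠ 0))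
    fun m hm => (Finset.mem_filter.1 hm).2
  choose k hk hk' using fun i =>
    (McN.proj i).2.exists_min_add_nat_mul hg (3 * v i)
  have hκ : ∀ i x, (k i x : ℝ) = min 1 ((x i : ℝ) + 3 * v i * g x) := fun i x => by
    rw [hk']; push_cast; rfl
  let w : Fin n → (Fin n → ℤ) × ℤ → (Fin n → ℤ) × ℤ := fun i p =>
    (Pi.single i 1 + (3 * (v i : ℤ)) • p.1, 3 * v i * p.2)
  have hw : ∀ i p x, (g x : ℝ) = intAffine p x →
      intAffine (w i p) x = (x i : ℝ) + 3 * v i * g x := by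
    intro i p x h
    rw [h]
    simp [w, intAffine, add_mul, Finset.sum_add_distrib, mul_add, Finset.mul_sum, Pi.single_apply,
      mul_assoc, add_assoc]
  refine ⟨fun x i => k i x, hk, fun x hx => funext fun i => Subtype.ext ?_,
    Fintype.piFinset fun i => insert (0, 1) (S.image (w i)), fun x hx => ?_⟩
  · rw [hκ, hx, mul_zero, add_zero, min_eq_right (x i).2.2]
  obtain ⟨p, hp, hpx⟩ := hS x
  have hpos : 0 < (g x : ℝ) := lt_of_le_of_ne (g x).2.1 (Ne.symm hx)
  refine ⟨fun i => if 1 ≤ (x i : ℝ) + 3 * v i * g x then (0, 1) else w i p,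
    Fintype.mem_piFinset.2 fun i => ?_, fun i => ?_, ?_⟩
  · split_ifs
    · exact Finset.mem_insert_self _ _
    · exact Finset.mem_insert_of_mem (Finset.mem_image_of_mem _ hp)
  · rw [hκ]
    beta_reduce
    split_ifs with h
    · rw [min_eq_left h]; simp [intAffine]
    · rw [min_eq_right (not_le.1 h).le, hw i p x hpx]
  · by_cases hcl : ∃ i, 1 ≤ (x i : ℝ) + 3 * v i * g x
    · obtain ⟨i, hi⟩ := hcl
      rw [Matrix.det_eq_zero_of_row_eq_zero i fun j => by simp [linearPart, hi]]
      exact not_isUnit_zero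
    · push Not at hcl
      -- A piece of `g` with zero linear part is an integer constant, here at least `1`, and would
      -- have truncated coordinate `0`.
      have hm : p.1 ≠ 0 := by
        intro h0
        have h1 : (g x : ℝ) = p.2 := by rw [hpx]; simp [intAffine, h0]
        rw [h1] at hpos
        have h2 : (1 : ℝ) ≤ g x := by
          rw [h1]; exact_mod_cast (Int.cast_pos.1 hpos)
        have h3 : (1 : ℝ) ≤ v ⟨0, hn⟩ := by exact_mod_cast hv ⟨0, hn⟩
        have h4 := hcl ⟨0, hn⟩
        have h5 := (x ⟨0, hn⟩).2.1
        nlinarith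
      have e : (linearPart fun i => if 1 ≤ (x i : ℝ) + 3 * v i * g x then (0, 1) else w i p) =
          Matrix.of fun i => (Pi.single i 1 + (3 * (v i : ℤ)) • p.1 : Fin n → ℤ) := by
        ext i j
        simp [linearPart, not_le.2 (hcl i), w]
      rw [e]
      exact not_isUnit_det_one_add _ _ (hvS p.1 (Finset.mem_filter.2
        ⟨Finset.mem_image_of_mem _ hp, hm⟩))

/-! ### `ℤ`-retractions and the retracts they induce. -/

theorem IsZRetraction.apply_apply {n : ℕ} {σ : UnitCube n → UnitCube n} (hσ : IsZRetraction σ)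
    (x : UnitCube n) : σ (σ x) = σ x := congrFun hσ.idem x

theorem IsZRetraction.mem_range_iff {n : ℕ} {σ : UnitCube n → UnitCube n} (hσ : IsZRetraction σ)
    {x : UnitCube n} : x ∈ Set.range σ ↔ σ x = x := by
  refine ⟨?_, fun h => ⟨x, h⟩⟩
  rintro ⟨y, rfl⟩
  exact hσ.apply_apply y

namespace McN

variable {n : ℕ}

theorem precomp_isRetractionOnto {σ : UnitCube n → UnitCube n} (hσ : IsZRetraction σ) :
    (precomp σ hσ.isZMap).IsRetractionOnto (precomp σ hσ.isZMap).range :=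
  ⟨fun f => Subtype.ext (funext fun x => congrArg f.1 (hσ.apply_apply x)), rfl⟩

/-- If the retraction `- ∘ τ` fixes every function of the form `f ∘ σ`, then `σ ∘ τ = σ`. -/
theorem comp_eq_of_range_le {σ τ : UnitCube n → UnitCube n} (hσ : IsZMap σ) (hτ : IsZMap τ)
    (hidem : ∀ f, precomp τ hτ (precomp τ hτ f) = precomp τ hτ f)
    (h : (precomp σ hσ).range = (precomp τ hτ).range) (x : UnitCube n) : σ (τ x) = σ x := by
  funext i
  have hmem : precomp σ hσ (proj i) ∈ (precomp τ hτ).range.carrier := by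
    rw [← h]; exact ⟨proj i, rfl⟩
  obtain ⟨f, hf⟩ := hmem
  have h1 := hidem f
  have h2 : precomp τ hτ (precomp σ hσ (proj i)) = precomp σ hσ (proj i) := by
    rw [← hf]; exact h1
  exact congrFun (congrArg Subtype.val h2) x

/-- `ℤ`-retractions with the same range induce isomorphic retracts. -/
theorem range_precomp_isomorphic {σ τ : UnitCube n → UnitCube n} (hσ : IsZRetraction σ)
    (hτ : IsZRetraction τ) (h : Set.range σ = Set.range τ) :
    MVIsomorphic (precomp σ hσ.isZMap).range (precomp τ hτ.isZMap).range := by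
  have hστ : ∀ x, σ (τ x) = τ x := fun x => hσ.mem_range_iff.1 (h ▸ ⟨x, rfl⟩)
  have hτσ : ∀ x, τ (σ x) = σ x := fun x => hτ.mem_range_iff.1 (h ▸ ⟨x, rfl⟩)
  -- Both retracts are determined by restriction to the common image; precomposing with `τ` sends `f
  -- ∘ σ` to `f ∘ τ`.
  refine ⟨{ toFun := fun f => ⟨precomp τ hτ.isZMap f.1, f.1, rfl⟩
            map_zero := rfl
            map_neg := fun _ => rfl
            map_oplus := fun _ _ => rfl }, ?_, ?_⟩
  · rintro ⟨_, f, rfl⟩ ⟨_, g, rfl⟩ hfg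
    have h1 : ∀ x, f.1 (σ (τ x)) = g.1 (σ (τ x)) := fun x =>
      congrFun (congrArg (fun a => a.1.1) hfg) x
    refine Subtype.ext (Subtype.ext (funext fun x => ?_))
    have h2 := h1 (σ x)
    rw [hτσ, hσ.apply_apply] at h2
    exact h2
  · rintro ⟨_, g, rfl⟩
    refine ⟨⟨precomp σ hσ.isZMap g, g, rfl⟩, Subtype.ext (Subtype.ext (funext fun x => ?_))⟩
    exact congrArg g.1 (hστ x)

end McN

/-! ### The retraction `ρ ∘ κ` and its uniqueness. -/

theorem mainTheorem11 (n : ℕ) (hn : 1 ≤ n) (A : MVSubalgebra (McN n))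
    (ρ : UnitCube n → UnitCube n) (hρ : IsZRetraction ρ)
    (hA : A = (McN.precomp ρ hρ.isZMap).range)
    (P : Set (UnitCube n)) (hP : Set.range ρ = P) (hdom : IsClosedDomain P) :
    ∃ (A' : MVSubalgebra (McN n)) (ρ' : UnitCube n → UnitCube n) (hρ' : IsZRetraction ρ'),
      A' = (McN.precomp ρ' hρ'.isZMap).range ∧
      Set.range ρ' = P ∧
      A'.IsRetract ∧
      MVIsomorphic A A' ∧
      A'.retractMultiplicity = 1 := by
  have hid : IsZMap (id : UnitCube n → UnitCube n) := fun i => (McN.proj i).2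
  obtain ⟨g, hg, hg0⟩ := hρ.isZMap.exists_zero_iff_eq hid
  have hgP : ∀ x, (g x : ℝ) = 0 ↔ x ∈ P := fun x => by
    rw [hg0, ← hP, hρ.mem_range_iff]; rfl
  obtain ⟨κ, hκ, hκP, T, hT⟩ := hg.exists_isZMap_fixing_zeros hn
  have hfix : ∀ x ∈ P, ρ (κ x) = x := fun x hx => by
    rw [hκP x ((hgP x).2 hx)]
    exact hρ.mem_range_iff.1 (hP ▸ hx)
  have hmem : ∀ x, ρ x ∈ P := fun x => hP ▸ ⟨x, rfl⟩
  have hρ' : IsZRetraction (ρ ∘ κ) :=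
    ⟨hρ.isZMap.comp hκ, funext fun x => hfix _ (hmem _)⟩
  have hrange : Set.range (ρ ∘ κ) = P :=
    Set.Subset.antisymm (by rintro _ ⟨x, rfl⟩; exact hmem _) fun x hx => ⟨x, hfix x hx⟩
  have hret := McN.precomp_isRetractionOnto hρ'
  refine ⟨_, ρ ∘ κ, hρ', rfl, hrange, ⟨_, hret⟩, ?_, ?_⟩
  · subst hA
    exact McN.range_precomp_isomorphic hρ hρ' (hP.trans hrange.symm)
  refine Set.encard_eq_one.2 ⟨_, Set.eq_singleton_iff_unique_mem.2 ⟨hret, fun ε hε => ?_⟩⟩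
  obtain ⟨σ, hσ, rfl⟩ := McN.exists_eq_precomp ε
  have h1 : ∀ x, ρ (κ (σ x)) = ρ (κ x) := McN.comp_eq_of_range_le hρ'.isZMap hσ hε.1 hε.2.symm
  have h2 : ∀ x, σ (ρ (κ x)) = σ x := McN.comp_eq_of_range_le hσ hρ'.isZMap hret.1 hε.2
  have hPclosed : IsClosed P := by
    rw [← hdom]; exact isClosed_closure
  have hint : ∀ x ∈ interior P, σ x ∈ P := by
    intro x hx
    by_contra hxP
    -- The points of the interior that `σ` moves out of `P` form an open set, on which only
    -- non-unimodular pieces of `κ` are met.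
    refine isUnit_det_of_comp_eq_id hρ.isZMap hκ.continuous hσ
      (isOpen_interior.inter (hPclosed.isOpen_compl.preimage hσ.continuous)) ⟨x, hx, hxP⟩
      (fun y hy => ?_) T (fun y hy => hT _ fun h => hy.2 ((hgP _).1 h))
    rw [h1, hfix y (interior_subset hy.1)]
  have hσint : ∀ x ∈ interior P, σ x = x := fun x hx => by
    rw [← hfix _ (hint x hx), h1, hfix x (interior_subset hx)]
  have hσP : ∀ x ∈ P, σ x = x := by
    intro x hx
    rw [← hdom] at hx
    exact closure_minimal hσint (isClosed_eq hσ.continuous continuous_id) hx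
  have hσρ : σ = ρ ∘ κ := funext fun x => by
    rw [← h2, hσP _ (hmem _)]; rfl
  subst hσρ
  rfl
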